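/- Let $d\ge 1$ and $\lambda>0$, and let $L$ be a homogeneous Poisson point process of intensity $\lambda$ on $\mathbb{R}^d$, i.e. a random set of points such that the number of points in each Borel set of finite volume has the Poisson distribution with mean $\lambda$ times its volume, and the numbers of points in (finitely many) pairwise disjoint such sets are independent. Write $\mathbb{N}=\{0,1,2,\dots\}$, and for $S\subsetneq\mathbb{N}$ let $\operatorname{mex} S:=\min(\mathbb{N}\setminus S)$. For an unordered pair of distinct points $x,y\in L$, let $F(x,y)$ be the set of unordered pairs $\{u,v\}$ of distinct points of $L$ that share exactly one point with $\{x,y\}$ and satisfy $|u-v|<|x-y|$ (the positions reachable from $\{x,y\}$ in one move of the game of friendly frogs). Then, with probability $1$, there exists a map $G$ assigning an element of $\mathbb{N}$ to each unordered pair of distinct points of $L$, such that: (i) for every $x\in L$ and every $k\in\mathbb{N}$ there is a unique $y\in L$, $y\neq x$, with $G(x,y)=k$; (ii) for each pair of distinct points $x,y\in L$, the set $\{G(u,v):\{u,v\}\in F(x,y)\}$ is a proper subset of $\mathbb{N}$, and $G(x,y)=\operatorname{mex}\{G(u,v):\{u,v\}\in F(x,y)\}$. -/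

import Mathlib

open MeasureTheory ProbabilityTheory
open scoped NNReal

namespace FriendlyFrogs

/-- A random set `L` of points of `ℝ^d`, on the probability space `(Ω, μ)`, is a homogeneous Poisson
point process of intensity `lam`: every Borel set of finite volume contains a random number of
points that has the Poisson law with mean `lam` times its volume, and the numbers of points in
finitely many pairwise disjoint Borel sets of finite volume are independent.
The numbers of points are counted in `ℕ∞`. -/
structure IsPoissonProcess {Ω : Type*} [MeasurableSpace Ω] {d : ℕ}
    (L : Ω → Set (EuclideanSpace ℝ (Fin d))) (lam : ℝ≥0) (μ : Measure Ω) : Prop where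
  hasLaw_count : ∀ B : Set (EuclideanSpace ℝ (Fin d)), MeasurableSet B → volume B < ⊤ →
    HasLaw (fun ω => (L ω ∩ B).encard)
      ((poissonMeasure (lam * (volume B).toNNReal)).map (fun n : ℕ => (n : ℕ∞))) μ
  iIndepFun_count : ∀ (n : ℕ) (B : Fin n → Set (EuclideanSpace ℝ (Fin d))),
    (∀ i, MeasurableSet (B i)) → (∀ i, volume (B i) < ⊤) →
    Pairwise (fun i j => Disjoint (B i) (B j)) →
    iIndepFun (fun (i : Fin n) (ω : Ω) => (L ω ∩ B i).encard) μ

/-- The unordered pairs of distinct points of `L`, i.e. the positions of the game with both frogs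
on the board. -/
def pairs {E : Type*} (L : Set E) : Set (Sym2 E) :=
  {p | ¬ p.IsDiag ∧ ∀ x ∈ p, x ∈ L}

/-- The distance between the two points of an unordered pair. -/
noncomputable def pairDist {E : Type*} [MetricSpace E] (p : Sym2 E) : ℝ :=
  Sym2.lift ⟨fun x y => dist x y, dist_comm⟩ p

/-- The positions that can be reached from the position `p` by one legal move of friendly frogs:
the pairs that share exactly one point with `p` and are strictly closer to each other. -/
def moves {E : Type*} [MetricSpace E] {L : Set E} (p : pairs L) : Set (pairs L) :=
  {q | pairDist q.1 < pairDist p.1 ∧ ∃! z : E, z ∈ p.1 ∧ z ∈ q.1}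

/-- The minimum excluded value of a set `S` of natural numbers; meaningful for `S ≠ Set.univ`. -/
noncomputable def mex (S : Set ℕ) : ℕ := sInf Sᶜ

end FriendlyFrogs

/-!
For a locally finite set of points in which distances from a point to two others differ and no play
lasts forever, the Sprague–Grundy values exist (`grundy`, `grundy_eq`), and they are the only
candidate for `G`. Two pairs with a common point have different values, because the shorter pair can
be reached from the longer one (`eq_of_grundy_eq`), so that the pairs of value `k` form a matching.
Two points that this matching leaves out form a pair of value less than `k`; hence at most `k + 1`
points are left out (`finite_unmatched`). By translation invariance, a finite random set that is
determined by the process in a translation-equivariant way is almost surely empty: disjoint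
translates of a ball meet it with the same probability, but only finitely many of them do so
(`IsPoissonProcess.ae_unmatched_eq_empty`). Therefore all points are matched.

The Poisson process enters through two facts.

* The law of a random set on the σ-algebra generated by the void events is determined by the void
  probabilities (`measure_mem_eq_of_void`), as these events form a π-system. This gives the
  invariance. The event that some point of a ball is left out belongs to this σ-algebra
  (`measurableSet_lackEvent`), because the points can be labelled measurably by the sets of a
  countable basis, and the Sprague–Grundy values are limits of the countable recursion `HasValueAt`.
* The probability to find an `n`-tuple of distinct points in a set `K` is at most the measure of `K`
  for the `n`-th power of the intensity measure (`IsPoissonProcess.measure_exists_tuple_le`).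
  Applied to isosceles triples, this shows that distances differ. Applied to paths with `n` steps
  whose lengths lie in a small interval, it gives a geometrically decreasing bound, so that the
  graph of the pairs with such distances has finite components almost surely. As the distances along
  an infinite play would converge, the play would remain in one of these components, which is
  impossible (`wellFounded_moves`, `IsPoissonProcess.ae_good`).
-/

namespace FriendlyFrogs

/-! ### Sprague–Grundy values on a set of points -/

section Game

theorem mk_mem_pairs {E : Type*} {S : Set E} {x y : E} :
    s(x, y) ∈ pairs S ↔ x ≠ y ∧ x ∈ S ∧ y ∈ S := by
  simp [pairs]

variable {E : Type*} [MetricSpace E]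

theorem mex_notMem {M : Set ℕ} (hM : M ≠ Set.univ) : mex M ∉ M :=
  Nat.sInf_mem (Set.nonempty_compl.2 hM)

theorem mem_of_lt_mex {M : Set ℕ} {m : ℕ} (h : m < mex M) : m ∈ M := by
  by_contra hm
  exact Nat.notMem_of_lt_sInf h hm

theorem eq_mex_iff {M : Set ℕ} (hM : M ≠ Set.univ) {k : ℕ} :
    mex M = k ↔ (∀ m < k, m ∈ M) ∧ k ∉ M := by
  constructor
  · rintro rfl
    exact ⟨fun m hm => mem_of_lt_mex hm, mex_notMem hM⟩
  · rintro ⟨h1, h2⟩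
    rcases lt_trichotomy (mex M) k with h | h | h
    · exact absurd (h1 _ h) (mex_notMem hM)
    · exact h
    · exact absurd (mem_of_lt_mex h) h2

@[simp] theorem pairDist_mk (x y : E) : pairDist s(x, y) = dist x y := rfl

/-- The move relation on all unordered pairs: the new pair is strictly shorter and shares a point
with the old one. -/
def IsMove (p q : Sym2 E) : Prop := pairDist q < pairDist p ∧ ∃ z, z ∈ p ∧ z ∈ q

theorem isMove_mk_iff (a b c d : E) :
    IsMove s(a, b) s(c, d) ↔ dist c d < dist a b ∧ ((a = c ∨ a = d) ∨ b = c ∨ b = d) := by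
  simp [IsMove, or_and_right, exists_or]

theorem mem_moves_iff {S : Set E} {p q : pairs S} : q ∈ moves p ↔ IsMove p.1 q.1 := by
  refine ⟨fun h => ⟨h.1, h.2.exists⟩, fun h => ⟨h.1, ?_⟩⟩
  obtain ⟨z, hz⟩ := h.2
  refine ⟨z, hz, fun w hw => ?_⟩
  by_contra hne
  -- two common points would make the pairs equal, hence equally long
  have hp := (Sym2.mem_and_mem_iff hne).1 ⟨hw.1, hz.1⟩
  have hq := (Sym2.mem_and_mem_iff hne).1 ⟨hw.2, hz.2⟩
  exact h.1.ne (by rw [hp, hq])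

/-- A set of points is locally finite if it has finitely many points in each ball. -/
def LocallyFiniteSet (S : Set E) : Prop := ∀ x r, (S ∩ Metric.closedBall x r).Finite

theorem finite_moves {S : Set E} (hS : LocallyFiniteSet S) (p : pairs S) : (moves p).Finite := by
  obtain ⟨p, hp⟩ := p
  induction p with | _ x y
  have hfin := ((hS x (dist x y)).image (fun v => s(x, v))).union
    ((hS y (dist x y)).image (fun v => s(y, v)))
  refine Set.Finite.of_finite_image (f := Subtype.val) (hfin.subset ?_) Subtype.val_injective.injOn
  rintro _ ⟨⟨q, hq⟩, hm, rfl⟩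
  obtain ⟨hd, z, hz, hzq⟩ := mem_moves_iff.1 hm
  obtain ⟨v, rfl⟩ := Sym2.mem_iff_exists.1 hzq
  have hv : v ∈ S := hq.2 v (by simp)
  simp only [pairDist_mk] at hd
  rcases Sym2.mem_iff.1 hz with rfl | rfl
  · exact Or.inl ⟨v, ⟨hv, by rw [Metric.mem_closedBall, dist_comm]; exact hd.le⟩, rfl⟩
  · exact Or.inr ⟨v, ⟨hv, by rw [Metric.mem_closedBall, dist_comm]; exact hd.le⟩, rfl⟩

/-- The properties of a set of points that make friendly frogs a well-behaved game: it is locally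
finite, no point has two others at the same distance, and no play lasts forever. -/
structure Good (S : Set E) : Prop where
  locallyFinite : LocallyFiniteSet S
  dist_ne : ∀ x ∈ S, ∀ y ∈ S, ∀ z ∈ S, x ≠ y → x ≠ z → y ≠ z → dist x y ≠ dist x z
  wf : WellFounded (fun q p : pairs S => q ∈ moves p)

/-- The Sprague–Grundy value of a position. -/
noncomputable def grundy {S : Set E} (hS : Good S) : pairs S → ℕ :=
  hS.wf.fix (fun p ih => mex {n | ∃ q, ∃ h : q ∈ moves p, ih q h = n})

theorem grundy_eq {S : Set E} (hS : Good S) (p : pairs S) :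
    grundy hS p = mex (grundy hS '' moves p) := by
  unfold grundy
  rw [WellFounded.fix_eq]
  congr 1
  ext n
  simp

theorem image_grundy_ne_univ {S : Set E} (hS : Good S) (p : pairs S) :
    grundy hS '' moves p ≠ Set.univ := fun h =>
  Set.infinite_univ (h ▸ (finite_moves hS.locallyFinite p).image _)

theorem grundy_eq_iff {S : Set E} (hS : Good S) (p : pairs S) (k : ℕ) :
    grundy hS p = k ↔ (∀ m < k, m ∈ grundy hS '' moves p) ∧ k ∉ grundy hS '' moves p := by
  rw [grundy_eq, eq_mex_iff (image_grundy_ne_univ hS p)]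

theorem grundy_ne_of_mem_moves {S : Set E} (hS : Good S) {p q : pairs S} (h : q ∈ moves p) :
    grundy hS q ≠ grundy hS p := fun he =>
  ((grundy_eq_iff hS p _).1 rfl).2 ⟨q, h, he⟩

/-- No point has two partners for the same value: the shorter of the two pairs could be reached
from the longer one. -/
theorem eq_of_grundy_eq {S : Set E} (hS : Good S) {x y z : E} (hy : s(x, y) ∈ pairs S)
    (hz : s(x, z) ∈ pairs S) (h : grundy hS ⟨_, hy⟩ = grundy hS ⟨_, hz⟩) : y = z := by
  by_contra hne
  have hy' := mk_mem_pairs.1 hy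
  have hz' := mk_mem_pairs.1 hz
  rcases (hS.dist_ne x hy'.2.1 y hy'.2.2 z hz'.2.2 hy'.1 hz'.1 hne).lt_or_gt with hlt | hlt
  · exact grundy_ne_of_mem_moves hS (p := ⟨_, hz⟩) (q := ⟨_, hy⟩)
      (mem_moves_iff.2 ⟨hlt, x, by simp, by simp⟩) h
  · exact grundy_ne_of_mem_moves hS (p := ⟨_, hy⟩) (q := ⟨_, hz⟩)
      (mem_moves_iff.2 ⟨hlt, x, by simp, by simp⟩) h.symm

/-- The points of `S` that have no partner for the value `k`. -/
def unmatched {S : Set E} (hS : Good S) (k : ℕ) : Set E :=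
  {x | x ∈ S ∧ ∀ y, ∀ h : s(x, y) ∈ pairs S, grundy hS ⟨_, h⟩ ≠ k}

/-- Two points without a `k`-partner form a pair of value less than `k`: a larger value would
require a pair of value `k` at one of them. As values at a point are distinct, there are at most
`k + 1` such points. -/
theorem finite_unmatched {S : Set E} (hS : Good S) (k : ℕ) : (unmatched hS k).Finite := by
  rcases (unmatched hS k).eq_empty_or_nonempty with h0 | ⟨x, hx⟩
  · simp [h0]
  have hlt : ∀ y ∈ unmatched hS k, ∀ h : s(x, y) ∈ pairs S, grundy hS ⟨_, h⟩ < k := by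
    intro y hy h
    by_contra hge
    have hk : k < grundy hS ⟨_, h⟩ := lt_of_le_of_ne (not_lt.1 hge) (hx.2 y h).symm
    obtain ⟨⟨q, hq⟩, hm, hqk⟩ := ((grundy_eq_iff hS _ _).1 rfl).1 k hk
    obtain ⟨-, z, hz, hzq⟩ := mem_moves_iff.1 hm
    obtain ⟨v, rfl⟩ := Sym2.mem_iff_exists.1 hzq
    rcases Sym2.mem_iff.1 hz with rfl | rfl
    · exact hx.2 v hq hqk
    · exact hy.2 v hq hqk
  classical
  let f : E → ℕ := fun y => if h : s(x, y) ∈ pairs S then grundy hS ⟨_, h⟩ else 0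
  have hfin : (unmatched hS k \ {x}).Finite := by
    have hp : ∀ y ∈ unmatched hS k \ {x}, s(x, y) ∈ pairs S := fun y hy =>
      mk_mem_pairs.2 ⟨fun h => hy.2 h.symm, hx.1, hy.1.1⟩
    refine Set.Finite.of_finite_image (f := f) ((Set.finite_Iio k).subset ?_) ?_
    · rintro _ ⟨y, hy, rfl⟩
      simp only [f, hp y hy, dif_pos, Set.mem_Iio]
      exact hlt y hy.1 (hp y hy)
    · intro y hy z hz hyz
      simp only [f, hp y hy, hp z hz, dif_pos] at hyz
      exact eq_of_grundy_eq hS _ _ hyz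
  exact (hfin.insert x).subset fun y hy => by
    by_cases h : y = x <;> simp [h, hy]

/-- Stage `t` of a recursion that computes the Sprague–Grundy values of the game on `S`: at stage
`0` no pair has a value, and a pair has the value `k` at stage `t + 1` if at stage `t` the moves
from it reach all values below `k`, but not `k`. -/
def HasValueAt (S : Set E) : ℕ → ℕ → Sym2 E → Prop
  | 0, _, _ => False
  | t + 1, k, p => (∀ m < k, ∃ q ∈ pairs S, IsMove p q ∧ HasValueAt S t m q) ∧
      ¬ ∃ q ∈ pairs S, IsMove p q ∧ HasValueAt S t k q

/-- The value of `p` is `k` from some stage on. -/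
def HasValue (S : Set E) (k : ℕ) (p : Sym2 E) : Prop := ∃ T, ∀ t, T ≤ t → HasValueAt S t k p

/-- The recursion is eventually correct at each position: by induction on the well-founded move
relation, as there are finitely many moves from a position. -/
theorem exists_hasValueAt_iff {S : Set E} (hS : Good S) (p : pairs S) :
    ∃ T, ∀ t, T ≤ t → ∀ k, HasValueAt S t k p.1 ↔ grundy hS p = k := by
  induction p using hS.wf.induction with | _ p ih
  choose! T hT using ih
  obtain ⟨M, hM⟩ := ((finite_moves hS.locallyFinite p).image T).bddAbove
  refine ⟨M + 1, fun t ht k => ?_⟩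
  obtain ⟨t, rfl⟩ : ∃ s, t = s + 1 := ⟨t - 1, by omega⟩
  have key : ∀ m, (∃ q ∈ pairs S, IsMove p.1 q ∧ HasValueAt S t m q) ↔
      m ∈ grundy hS '' moves p := by
    intro m
    constructor
    · rintro ⟨q, hq, hpq, hv⟩
      have hmem : (⟨q, hq⟩ : pairs S) ∈ moves p := mem_moves_iff.2 hpq
      exact ⟨⟨q, hq⟩, hmem, (hT _ hmem t ((hM ⟨_, hmem, rfl⟩).trans (by omega)) m).1 hv⟩
    · rintro ⟨q, hmem, hv⟩
      exact ⟨q.1, q.2, mem_moves_iff.1 hmem,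
        (hT _ hmem t ((hM ⟨_, hmem, rfl⟩).trans (by omega)) m).2 hv⟩
  rw [grundy_eq_iff]
  simp only [HasValueAt, key]

theorem hasValue_iff {S : Set E} (hS : Good S) (p : pairs S) (k : ℕ) :
    HasValue S k p.1 ↔ grundy hS p = k := by
  obtain ⟨T, hT⟩ := exists_hasValueAt_iff hS p
  constructor
  · rintro ⟨T', hT'⟩
    exact (hT (max T T') (le_max_left _ _) k).1 (hT' _ (le_max_right _ _))
  · exact fun h => ⟨T, fun t ht => (hT t ht k).2 h⟩

/-- `x` has no partner for the value `k`, in terms of the recursive stages. -/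
def Lacks (S : Set E) (k : ℕ) (x : E) : Prop := ∀ y ∈ S, x ≠ y → ¬ HasValue S k s(x, y)

theorem mem_unmatched_iff {S : Set E} (hS : Good S) (k : ℕ) (x : E) :
    x ∈ unmatched hS k ↔ x ∈ S ∧ Lacks S k x := by
  refine and_congr_right fun hx => ⟨fun h y hy hxy hv => ?_, fun h y hp hv => ?_⟩
  · have hp : s(x, y) ∈ pairs S := mk_mem_pairs.2 ⟨hxy, hx, hy⟩
    exact h y hp ((hasValue_iff hS ⟨_, hp⟩ k).1 hv)
  · have hp' := mk_mem_pairs.1 hp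
    exact h y hp'.2.2 hp'.1 ((hasValue_iff hS ⟨_, hp⟩ k).2 hv)

theorem pairDist_map (f : E ≃ᵢ E) (p : Sym2 E) : pairDist (p.map f) = pairDist p := by
  induction p with | _ x y
  simp [f.isometry.dist_eq]

theorem isMove_map (f : E ≃ᵢ E) (p q : Sym2 E) : IsMove (p.map f) (q.map f) ↔ IsMove p q := by
  simp only [IsMove, pairDist_map, Sym2.mem_map]
  refine and_congr_right fun _ => ⟨?_, ?_⟩
  · rintro ⟨_, ⟨a, ha, rfl⟩, b, hb, hab⟩
    exact ⟨a, ha, f.injective hab ▸ hb⟩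
  · rintro ⟨z, h1, h2⟩
    exact ⟨f z, ⟨z, h1, rfl⟩, z, h2, rfl⟩

theorem map_mem_pairs (f : E ≃ᵢ E) (S : Set E) (p : Sym2 E) :
    p.map f ∈ pairs (f '' S) ↔ p ∈ pairs S := by
  induction p with | _ x y
  simp [mk_mem_pairs, f.injective.eq_iff]

theorem hasValueAt_map (f : E ≃ᵢ E) (S : Set E) (t k : ℕ) (p : Sym2 E) :
    HasValueAt (f '' S) t k (p.map f) ↔ HasValueAt S t k p := by
  induction t generalizing k p with
  | zero => simp [HasValueAt]
  | succ t ih =>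
    have hsurj : Function.Surjective (Sym2.map f) := fun q => by
      induction q with | _ x y
      exact ⟨s(f.symm x, f.symm y), by simp⟩
    have key : ∀ m, (∃ q ∈ pairs (f '' S), IsMove (p.map f) q ∧ HasValueAt (f '' S) t m q) ↔
        ∃ q ∈ pairs S, IsMove p q ∧ HasValueAt S t m q := fun m => by
      rw [hsurj.exists]
      simp only [map_mem_pairs, isMove_map, ih]
    simp only [HasValueAt, key]

theorem lacks_image (f : E ≃ᵢ E) (S : Set E) (k : ℕ) (x : E) :
    Lacks (f '' S) k (f x) ↔ Lacks S k x := by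
  have h : ∀ y, HasValue (f '' S) k s(f x, f y) ↔ HasValue S k s(x, y) := fun y => by
    simp only [HasValue, ← hasValueAt_map f S, Sym2.map_mk]
  simp [Lacks, h, f.injective.eq_iff]

end Game

/-! ### Configurations and measurability -/

section Config

/-- A configuration of points of `E`. This is a copy of `Set E` that carries the σ-algebra
generated by the events that a given set of finite volume contains no point, rather than the product
σ-algebra of `E → Prop`. -/
structure Config (E : Type*) where
  /-- The set of points of a configuration. -/
  carrier : Set E

/-- The void events: a given Borel set of finite volume contains no point. -/
def voidEvents (E : Type*) [MeasureSpace E] : Set (Set (Config E)) :=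
  {A | ∃ B : Set E, MeasurableSet B ∧ volume B < ⊤ ∧ A = {S | Disjoint S.carrier B}}

instance (E : Type*) [MeasureSpace E] : MeasurableSpace (Config E) :=
  MeasurableSpace.generateFrom (voidEvents E)

theorem isPiSystem_voidEvents (E : Type*) [MeasureSpace E] : IsPiSystem (voidEvents E) := by
  rintro _ ⟨B, hB, hvB, rfl⟩ _ ⟨C, hC, hvC, rfl⟩ -
  refine ⟨B ∪ C, hB.union hC, measure_union_lt_top hvB hvC, ?_⟩
  ext S
  simp

/-- A random set of points has the same law as another one, on the σ-algebra of `Config E`, if it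
has the same void probabilities. -/
theorem measure_mem_eq_of_void {Ω E : Type*} [MeasurableSpace Ω] {μ : Measure Ω}
    [IsFiniteMeasure μ] [MeasureSpace E] {L L' : Ω → Set E}
    (h : ∀ B, MeasurableSet B → volume B < ⊤ →
      NullMeasurableSet {ω | Disjoint (L ω) B} μ ∧ NullMeasurableSet {ω | Disjoint (L' ω) B} μ ∧
      μ {ω | Disjoint (L ω) B} = μ {ω | Disjoint (L' ω) B})
    (A : Set (Config E)) (hA : MeasurableSet A) :
    NullMeasurableSet {ω | Config.mk (L ω) ∈ A} μ ∧
      NullMeasurableSet {ω | Config.mk (L' ω) ∈ A} μ ∧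
      μ {ω | Config.mk (L ω) ∈ A} = μ {ω | Config.mk (L' ω) ∈ A} := by
  induction A, hA using MeasurableSpace.induction_on_inter (s := voidEvents E) rfl
    (isPiSystem_voidEvents E) with
  | empty => simp
  | basic A hA =>
    obtain ⟨B, hB, hvB, rfl⟩ := hA
    exact h B hB hvB
  | compl A hA ih =>
    obtain ⟨h1, h2, h3⟩ := ih
    refine ⟨h1.compl, h2.compl, ?_⟩
    have e := measure_compl₀ h1 (measure_ne_top _ _)
    have e' := measure_compl₀ h2 (measure_ne_top _ _)
    rw [h3, ← e'] at e
    exact e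
  | iUnion f hd hf ih =>
    have e : ∀ M : Ω → Set E, {ω | Config.mk (M ω) ∈ ⋃ i, f i} =
        ⋃ i, {ω | Config.mk (M ω) ∈ f i} := fun M => by ext; simp
    simp only [e]
    refine ⟨.iUnion fun i => (ih i).1, .iUnion fun i => (ih i).2.1, ?_⟩
    have hdis : ∀ M : Ω → Set E,
        Pairwise (Function.onFun (AEDisjoint μ) fun i => {ω | Config.mk (M ω) ∈ f i}) :=
      fun M i j hij => ((hd hij).preimage fun ω => Config.mk (M ω)).aedisjoint
    rw [measure_iUnion₀ (hdis L) fun i => (ih i).1, measure_iUnion₀ (hdis L') fun i => (ih i).2.1]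
    exact tsum_congr fun i => (ih i).2.2

theorem measurableSet_avoid {E : Type*} [MeasureSpace E]
    [SigmaFinite (volume : Measure E)] {B : Set E} (hB : MeasurableSet B) :
    MeasurableSet {S : Config E | Disjoint S.carrier B} := by
  have e : {S : Config E | Disjoint S.carrier B} =
      ⋂ n, {S : Config E | Disjoint S.carrier (B ∩ spanningSets volume n)} := by
    ext S
    simp only [Set.mem_ofPred_eq, Set.mem_iInter, ← Set.disjoint_iUnion_right,
      ← Set.inter_iUnion, iUnion_spanningSets, Set.inter_univ]
  rw [e]
  refine .iInter fun n => MeasurableSpace.measurableSet_generateFrom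
    ⟨_, hB.inter (measurableSet_spanningSets _ n), ?_, rfl⟩
  exact (measure_mono Set.inter_subset_right).trans_lt (measure_spanningSets_lt_top _ n)

theorem measurable_hits {E : Type*} [MeasureSpace E]
    [SigmaFinite (volume : Measure E)] {B : Set E} (hB : MeasurableSet B) :
    Measurable fun S : Config E => (S.carrier ∩ B).Nonempty := by
  have := (measurableSet_avoid hB).compl
  rw [← measurableSet_setOfPred]
  convert this using 1
  ext S
  simp [Set.not_disjoint_iff_nonempty_inter]

/-- A sequence that runs through a basis of the topology. -/
theorem exists_basis_seq (E : Type*) [TopologicalSpace E] [SecondCountableTopology E] :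
    ∃ b : ℕ → Set E, TopologicalSpace.IsTopologicalBasis (Set.range b) := by
  obtain ⟨s, hs, -, hb⟩ := TopologicalSpace.exists_countable_basis E
  rcases s.eq_empty_or_nonempty with rfl | hne
  · refine ⟨fun _ => ∅, ?_⟩
    have := hb.insert_empty
    simpa using this
  · obtain ⟨b, rfl⟩ := hs.exists_eq_range hne
    exact ⟨b, hb⟩

/-- The `n`-th set of a fixed countable basis of the topology. -/
noncomputable def basisSet (E : Type*) [TopologicalSpace E] [SecondCountableTopology E] (n : ℕ) :
    Set E := (exists_basis_seq E).choose n

theorem isTopologicalBasis_basisSet (E : Type*) [TopologicalSpace E]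
    [SecondCountableTopology E] : TopologicalSpace.IsTopologicalBasis (Set.range (basisSet E)) :=
  (exists_basis_seq E).choose_spec

theorem measurableSet_basisSet {E : Type*} [TopologicalSpace E]
    [SecondCountableTopology E] [MeasurableSpace E] [OpensMeasurableSpace E] (n : ℕ) :
    MeasurableSet (basisSet E n) :=
  ((isTopologicalBasis_basisSet E).isOpen ⟨n, rfl⟩).measurableSet

variable {E : Type*} [NormedAddCommGroup E] [SecondCountableTopology E]

theorem exists_basisSet_subset {x : E} {u : Set E} (hx : x ∈ u) (hu : IsOpen u) :
    ∃ n, x ∈ basisSet E n ∧ basisSet E n ⊆ u := by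
  obtain ⟨_, ⟨n, rfl⟩, h⟩ :=
    (isTopologicalBasis_basisSet E).exists_subset_of_mem_open hx hu
  exact ⟨n, h⟩

/-- The `n`-th basis set contains exactly one point of the configuration. -/
def IsLabel (n : ℕ) (S : Config E) : Prop := ∃! x, x ∈ S.carrier ∧ x ∈ basisSet E n

open Classical in
/-- The only point of the configuration in the `n`-th basis set, and `0` if there is no such
point. -/
noncomputable def labelled (n : ℕ) (S : Config E) : E :=
  if h : IsLabel n S then h.exists.choose else 0

theorem labelled_mem {n : ℕ} {S : Config E} (h : IsLabel n S) :
    labelled n S ∈ S.carrier ∧ labelled n S ∈ basisSet E n := by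
  rw [labelled, dif_pos h]
  exact h.exists.choose_spec

/-- The set of all labelled points of a configuration. For a locally finite one these are all
points, see `labelledPoints_eq`. -/
def labelledPoints (S : Config E) : Set E := {x | ∃ n, IsLabel n S ∧ labelled n S = x}

theorem labelledPoints_eq {S : Config E} (hS : LocallyFiniteSet S.carrier) :
    labelledPoints S = S.carrier := by
  ext x
  constructor
  · rintro ⟨n, h, rfl⟩
    exact (labelled_mem h).1
  · intro hx
    have hfin : ((S.carrier ∩ Metric.closedBall x 1) \ {x}).Finite := (hS x 1).sdiff
    have hopen : IsOpen (Metric.ball x 1 ∩ ((S.carrier ∩ Metric.closedBall x 1) \ {x})ᶜ) :=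
      Metric.isOpen_ball.inter hfin.isClosed.isOpen_compl
    obtain ⟨n, hn, hsub⟩ := exists_basisSet_subset
      (Set.mem_inter (Metric.mem_ball_self one_pos) (by simp)) hopen
    have huniq : ∀ y, y ∈ S.carrier ∧ y ∈ basisSet E n → y = x := by
      rintro y ⟨hy, hyn⟩
      by_contra hne
      exact (hsub hyn).2 ⟨⟨hy, Metric.ball_subset_closedBall (hsub hyn).1⟩, hne⟩
    have hl : IsLabel n S := ⟨x, ⟨hx, hn⟩, huniq⟩
    exact ⟨n, hl, huniq _ (labelled_mem hl)⟩

/-- A basis set contains exactly one point if it is hit, but not hit in two disjoint basis sets. This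
expresses the event by countably many void events. -/
theorem isLabel_iff (n : ℕ) (S : Config E) : IsLabel n S ↔
    (S.carrier ∩ basisSet E n).Nonempty ∧ ∀ i j, Disjoint (basisSet E i) (basisSet E j) →
      ¬ ((S.carrier ∩ (basisSet E n ∩ basisSet E i)).Nonempty ∧
        (S.carrier ∩ (basisSet E n ∩ basisSet E j)).Nonempty) := by
  constructor
  · rintro ⟨x, hx, hu⟩
    refine ⟨⟨x, hx⟩, ?_⟩
    rintro i j hij ⟨⟨y, hy, hyn, hyi⟩, ⟨z, hz, hzn, hzj⟩⟩
    have hyz : y = z := (hu y ⟨hy, hyn⟩).trans (hu z ⟨hz, hzn⟩).symm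
    exact Set.disjoint_left.1 hij hyi (hyz ▸ hzj)
  · rintro ⟨⟨x, hx⟩, h⟩
    refine ⟨x, hx, fun y hy => ?_⟩
    by_contra hne
    obtain ⟨u, v, hu, hv, hyu, hxv, huv⟩ := t2_separation hne
    obtain ⟨i, hi, hiu⟩ := exists_basisSet_subset hyu hu
    obtain ⟨j, hj, hjv⟩ := exists_basisSet_subset hxv hv
    exact h i j (huv.mono hiu hjv) ⟨⟨y, hy.1, hy.2, hi⟩, ⟨x, hx.1, hx.2, hj⟩⟩

theorem exists_mem_pairs_labelledPoints (S : Config E) (P : Sym2 E → Prop) :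
    (∃ q ∈ pairs (labelledPoints S), P q) ↔
      ∃ l m, IsLabel l S ∧ IsLabel m S ∧ labelled l S ≠ labelled m S ∧
        P s(labelled l S, labelled m S) := by
  constructor
  · rintro ⟨q, hq, hP⟩
    induction q with | _ x y
    obtain ⟨hne, ⟨l, hl, rfl⟩, m, hm, rfl⟩ := mk_mem_pairs.1 hq
    exact ⟨l, m, hl, hm, hne, hP⟩
  · rintro ⟨l, m, hl, hm, hne, hP⟩
    exact ⟨_, mk_mem_pairs.2 ⟨hne, ⟨l, hl, rfl⟩, m, hm, rfl⟩, hP⟩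

section Measurability

variable [MeasureSpace E] [BorelSpace E] [SigmaFinite (volume : Measure E)]

theorem measurable_isLabel (n : ℕ) : Measurable fun S : Config E => IsLabel n S := by
  simp only [isLabel_iff]
  have h : ∀ i, Measurable fun S : Config E =>
      (S.carrier ∩ (basisSet E n ∩ basisSet E i)).Nonempty := fun i =>
     measurable_hits ((measurableSet_basisSet n).inter (measurableSet_basisSet i))
  exact (measurable_hits (measurableSet_basisSet n)).and <| .forall fun i => .forall fun j =>
    measurable_const.imp ((h i).and (h j)).not

theorem measurable_labelled (n : ℕ) : Measurable fun S : Config E => labelled n S := by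
  intro B hB
  have e : (fun S : Config E => labelled n S) ⁻¹' B =
      {S | (IsLabel n S ∧ (S.carrier ∩ (basisSet E n ∩ B)).Nonempty) ∨
        (¬ IsLabel n S ∧ (0 : E) ∈ B)} := by
    ext S
    by_cases h : IsLabel n S
    · have hm := labelled_mem h
      simp only [Set.mem_preimage, Set.mem_ofPred_eq, h, true_and, not_true, false_and, or_false]
      refine ⟨fun hB => ⟨_, hm.1, hm.2, hB⟩, ?_⟩
      rintro ⟨x, hx, hxn, hxB⟩
      rwa [h.unique hm ⟨hx, hxn⟩]
    · simp [labelled, h]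
  rw [e, measurableSet_setOfPred]
  exact ((measurable_isLabel n).and (measurable_hits ((measurableSet_basisSet n).inter hB))).or
    ((measurable_isLabel n).not.and measurable_const)

theorem measurable_hasValueAt (t k i j : ℕ) : Measurable fun S : Config E =>
    HasValueAt (labelledPoints S) t k s(labelled i S, labelled j S) := by
  induction t generalizing k i j with
  | zero => exact measurable_const
  | succ t ih =>
    have hX := measurable_labelled (E := E)
    have heq : ∀ l m, Measurable fun S : Config E => labelled l S = labelled m S := fun l m =>
      measurableSet_setOfPred.1 (measurableSet_eq_fun (hX l) (hX m))
    have key : ∀ m, Measurable fun S : Config E => ∃ q ∈ pairs (labelledPoints S),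
        IsMove s(labelled i S, labelled j S) q ∧ HasValueAt (labelledPoints S) t m q := by
      intro m
      simp only [exists_mem_pairs_labelledPoints, isMove_mk_iff]
      refine .exists fun a => .exists fun b => (measurable_isLabel a).and <|
        (measurable_isLabel b).and <| (heq a b).not.and <| .and (.and ?_ ?_) (ih m a b)
      · exact measurableSet_setOfPred.1
          (measurableSet_lt ((hX a).dist (hX b)) ((hX i).dist (hX j)))
      · exact ((heq i a).or (heq i b)).or ((heq j a).or (heq j b))
    exact (Measurable.forall fun m => measurable_const.imp (key m)).and (key k).not

/-- The event that some point in `Q` has no partner for the value `k`. -/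
def lackEvent (k : ℕ) (Q : Set E) : Set (Config E) :=
  {S | ∃ x ∈ labelledPoints S, x ∈ Q ∧ Lacks (labelledPoints S) k x}

theorem measurableSet_lackEvent (k : ℕ) {Q : Set E} (hQ : MeasurableSet Q) :
    MeasurableSet (lackEvent k Q) := by
  have hX := measurable_labelled (E := E)
  have e : lackEvent k Q = {S | ∃ i, IsLabel i S ∧ labelled i S ∈ Q ∧
      ∀ j, IsLabel j S → labelled i S ≠ labelled j S →
        ¬ HasValue (labelledPoints S) k s(labelled i S, labelled j S)} := by
    ext S
    constructor
    · rintro ⟨_, ⟨i, hi, rfl⟩, hQ, h⟩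
      exact ⟨i, hi, hQ, fun j hj hne => h _ ⟨j, hj, rfl⟩ hne⟩
    · rintro ⟨i, hi, hQ, h⟩
      refine ⟨_, ⟨i, hi, rfl⟩, hQ, ?_⟩
      rintro _ ⟨j, hj, rfl⟩ hne
      exact h j hj hne
  rw [e, measurableSet_setOfPred]
  refine .exists fun i => (measurable_isLabel i).and <| .and ?_ <| .forall fun j =>
    (measurable_isLabel j).imp <| .imp ?_ <| .not <| .exists fun T => .forall fun t =>
      measurable_const.imp (measurable_hasValueAt t k i j)
  · exact measurableSet_setOfPred.1 (hX i hQ)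
  · exact (measurableSet_setOfPred.1 (measurableSet_eq_fun (hX i) (hX j))).not

end Measurability

end Config

/-! ### First-moment bounds for the Poisson process -/

section Moments

variable {Ω : Type*} [MeasurableSpace Ω] {μ : Measure Ω} {d : ℕ}
  {L : Ω → Set (EuclideanSpace ℝ (Fin d))} {lam : ℝ≥0}

theorem disjoint_iff_encard_inter {E : Type*} (S B : Set E) :
    Disjoint S B ↔ (S ∩ B).encard ∈ ({0} : Set ℕ∞) := by
  rw [Set.mem_singleton_iff, Set.encard_eq_zero, Set.disjoint_iff_inter_eq_empty]

theorem IsPoissonProcess.nullMeasurableSet_disjoint (hL : IsPoissonProcess L lam μ)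
    {B : Set (EuclideanSpace ℝ (Fin d))} (hB : MeasurableSet B) (hv : volume B < ⊤) :
    NullMeasurableSet {ω | Disjoint (L ω) B} μ := by
  simp only [disjoint_iff_encard_inter]
  exact (hL.hasLaw_count B hB hv).aemeasurable.nullMeasurable (measurableSet_singleton _)

theorem IsPoissonProcess.measure_disjoint (hL : IsPoissonProcess L lam μ)
    {B : Set (EuclideanSpace ℝ (Fin d))} (hB : MeasurableSet B) (hv : volume B < ⊤) :
    μ {ω | Disjoint (L ω) B} = ENNReal.ofReal (Real.exp (-(lam * (volume B).toNNReal))) := by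
  simp only [disjoint_iff_encard_inter]
  have := (hL.hasLaw_count B hB hv).measure_eq (p := fun n => n ∈ ({0} : Set ℕ∞))
    (measurableSet_singleton _)
  have e : (fun n : ℕ => (n : ℕ∞)) ⁻¹' {0} = {0} := by ext; simp
  rw [this]
  refine (Measure.map_apply (Measurable.of_discrete (f := fun n : ℕ => (n : ℕ∞)))
    (measurableSet_singleton _)).trans ?_
  rw [e, poissonMeasure_singleton]
  simp

theorem IsPoissonProcess.ae_finite_inter (hL : IsPoissonProcess L lam μ)
    {B : Set (EuclideanSpace ℝ (Fin d))} (hB : MeasurableSet B) (hv : volume B < ⊤) :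
    ∀ᵐ ω ∂μ, (L ω ∩ B).Finite := by
  have h := hL.hasLaw_count B hB hv
  have : ∀ᵐ n ∂(μ.map fun ω => (L ω ∩ B).encard), n ≠ ⊤ := by
    have hm : Measurable fun n : ℕ => (n : ℕ∞) := .of_discrete
    rw [h.map_eq]
    refine (ae_map_iff hm.aemeasurable (measurableSet_singleton _).compl).2 ?_
    simp
  filter_upwards [ae_of_ae_map h.aemeasurable this] with ω hω
  exact Set.encard_ne_top_iff.1 hω

theorem IsPoissonProcess.ae_locallyFiniteSet (hL : IsPoissonProcess L lam μ) :
    ∀ᵐ ω ∂μ, LocallyFiniteSet (L ω) := by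
  have : ∀ n : ℕ, ∀ᵐ ω ∂μ, (L ω ∩ Metric.closedBall 0 (n : ℝ)).Finite := fun n =>
    hL.ae_finite_inter measurableSet_closedBall measure_closedBall_lt_top
  filter_upwards [ae_all_iff.2 this] with ω h x r
  obtain ⟨n, hn⟩ := exists_nat_ge (r + dist x 0)
  exact (h n).subset (Set.inter_subset_inter_right _ (Metric.closedBall_subset_closedBall' hn))

theorem IsPoissonProcess.measure_not_disjoint_le [IsProbabilityMeasure μ]
    (hL : IsPoissonProcess L lam μ)
    {B : Set (EuclideanSpace ℝ (Fin d))} (hB : MeasurableSet B) (hv : volume B < ⊤) :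
    μ {ω | ¬ Disjoint (L ω) B} ≤ lam * volume B := by
  have h := prob_compl_eq_one_sub₀ (hL.nullMeasurableSet_disjoint hB hv)
  have e : {ω | Disjoint (L ω) B}ᶜ = {ω | ¬ Disjoint (L ω) B} := rfl
  rw [e] at h
  rw [h, hL.measure_disjoint hB hv, ← ENNReal.coe_toNNReal hv.ne, ENNReal.toNNReal_coe,
    ← ENNReal.coe_mul, tsub_le_iff_right, ← ENNReal.ofReal_coe_nnreal,
    ← ENNReal.ofReal_add (by positivity) (by positivity), ← ENNReal.ofReal_one]
  apply ENNReal.ofReal_le_ofReal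
  have := Real.add_one_le_exp (-((lam * (volume B).toNNReal : ℝ≥0) : ℝ))
  push_cast at this ⊢
  linarith

/-- The independence of the counts bounds the probability that each of finitely many disjoint sets
contains a point. -/
theorem IsPoissonProcess.measure_forall_not_disjoint_le [IsProbabilityMeasure μ]
    (hL : IsPoissonProcess L lam μ) {n : ℕ} {B : Fin n → Set (EuclideanSpace ℝ (Fin d))}
    (hB : ∀ i, MeasurableSet (B i)) (hv : ∀ i, volume (B i) < ⊤)
    (hd : Pairwise (fun i j => Disjoint (B i) (B j))) :
    μ {ω | ∀ i, ¬ Disjoint (L ω) (B i)} ≤ ∏ i, lam * volume (B i) := by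
  have h := (hL.iIndepFun_count n B hB hv hd).measure_inter_preimage_eq_mul
    Finset.univ (sets := fun _ => {0}ᶜ) fun i _ => (measurableSet_singleton _).compl
  have e : {ω | ∀ i, ¬ Disjoint (L ω) (B i)} =
      ⋂ i ∈ Finset.univ, (fun ω => (L ω ∩ B i).encard) ⁻¹' {0}ᶜ := by
    ext ω
    simp [disjoint_iff_encard_inter]
  rw [e, h]
  refine Finset.prod_le_prod' fun i _ => ?_
  have := hL.measure_not_disjoint_le (hB i) (hv i)
  simp only [disjoint_iff_encard_inter] at this
  exact this

/-- The intensity measure of the process. -/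
noncomputable def intensity (d : ℕ) (lam : ℝ≥0) : Measure (EuclideanSpace ℝ (Fin d)) :=
  lam • volume

instance : SFinite (intensity d lam) := by unfold intensity; infer_instance
instance : SigmaFinite (intensity d lam) := by unfold intensity; infer_instance

theorem intensity_apply (B : Set (EuclideanSpace ℝ (Fin d))) :
    intensity d lam B = lam * volume B := by
  rw [intensity, Measure.smul_apply, ENNReal.smul_def, smul_eq_mul]

/-- The probability that `L` contains an `n`-tuple from a set `K` that lies in a product of pairwise
disjoint sets is at most the measure of `K` for the product of the intensity measures. The left-hand
side is an outer measure as a function of `K`, so it suffices to consider products. -/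
theorem IsPoissonProcess.measure_exists_tuple_le_of_disjoint [IsProbabilityMeasure μ]
    (hL : IsPoissonProcess L lam μ) {n : ℕ} {B : Fin n → Set (EuclideanSpace ℝ (Fin d))}
    (hB : ∀ i, MeasurableSet (B i)) (hv : ∀ i, volume (B i) < ⊤)
    (hd : Pairwise (fun i j => Disjoint (B i) (B j)))
    {K : Set (Fin n → EuclideanSpace ℝ (Fin d))} (hK : MeasurableSet K) :
    μ {ω | ∃ x ∈ K, ∀ i, x i ∈ L ω ∩ B i} ≤ Measure.pi (fun _ => intensity d lam) K := by
  let θ : OuterMeasure (Fin n → EuclideanSpace ℝ (Fin d)) :=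
    { measureOf := fun K => μ {ω | ∃ x ∈ K, ∀ i, x i ∈ L ω ∩ B i}
      empty := by simp
      mono := fun {K K'} h => measure_mono fun ω ⟨x, hx, hx'⟩ => ⟨x, h hx, hx'⟩
      iUnion_nat := fun K _ => by
        refine (measure_mono ?_).trans (measure_iUnion_le _)
        rintro ω ⟨x, hx, hx'⟩
        obtain ⟨i, hi⟩ := Set.mem_iUnion.1 hx
        exact Set.mem_iUnion.2 ⟨i, x, hi, hx'⟩ }
  have hle : θ ≤ OuterMeasure.pi fun _ => (intensity d lam).toOuterMeasure := by
    rw [OuterMeasure.le_pi]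
    intro s _
    let t : Fin n → Set (EuclideanSpace ℝ (Fin d)) :=
      fun i => toMeasurable (intensity d lam) (s i) ∩ B i
    calc μ {ω | ∃ x ∈ Set.pi Set.univ s, ∀ i, x i ∈ L ω ∩ B i}
        ≤ μ {ω | ∀ i, ¬ Disjoint (L ω) (t i)} := by
          refine measure_mono ?_
          rintro ω ⟨x, hx, hx'⟩ i
          rw [Set.not_disjoint_iff]
          exact ⟨x i, (hx' i).1, subset_toMeasurable _ _ (hx i trivial), (hx' i).2⟩
      _ ≤ ∏ i, lam * volume (t i) := hL.measure_forall_not_disjoint_le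
          (fun i => (measurableSet_toMeasurable _ _).inter (hB i))
          (fun i => (measure_mono Set.inter_subset_right).trans_lt (hv i))
          (fun i j hij => (hd hij).mono Set.inter_subset_right Set.inter_subset_right)
      _ ≤ ∏ i, intensity d lam (s i) := by
          refine Finset.prod_le_prod' fun i _ => ?_
          rw [← intensity_apply, ← measure_toMeasurable (s i)]
          exact measure_mono Set.inter_subset_left
  rw [Measure.pi, toMeasure_apply _ _ hK]
  exact hle K

/-- The cell of the point `x` in the `N`-th of a sequence of finite partitions: it tells which of
the first `N` basis sets contain `x`. -/
def cell (d N : ℕ) (x : EuclideanSpace ℝ (Fin d)) : Fin N → Prop :=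
  fun i => x ∈ basisSet (EuclideanSpace ℝ (Fin d)) i

theorem measurableSet_cell_eq (N : ℕ) (c : Fin N → Prop) :
    MeasurableSet {x | cell d N x = c} := by
  have e : {x | cell d N x = c} =
      ⋂ i : Fin N, {x | x ∈ basisSet (EuclideanSpace ℝ (Fin d)) i ↔ c i} := by
    ext x
    simp [cell, funext_iff]
  rw [e]
  refine .iInter fun i => ?_
  have hm := measurableSet_basisSet (E := EuclideanSpace ℝ (Fin d)) i
  by_cases h : c i
  · simpa [h] using hm
  · have e' : {x | x ∈ basisSet (EuclideanSpace ℝ (Fin d)) i ↔ c i} =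
        (basisSet (EuclideanSpace ℝ (Fin d)) i)ᶜ := by ext; simp [h]
    rw [e']
    exact hm.compl

theorem cell_eq_of_le {N N' : ℕ} (h : N ≤ N') {x y : EuclideanSpace ℝ (Fin d)}
    (he : cell d N' x = cell d N' y) : cell d N x = cell d N y :=
  funext fun i => congrFun he (i.castLE h)

theorem exists_cell_ne {x y : EuclideanSpace ℝ (Fin d)} (h : x ≠ y) :
    ∃ N, cell d N x ≠ cell d N y := by
  obtain ⟨i, hi, hsub⟩ := exists_basisSet_subset (u := {y}ᶜ) h isOpen_compl_singleton
  refine ⟨i + 1, fun he => ?_⟩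
  have := congrFun he ⟨i, by omega⟩
  simp only [cell, hi, eq_iff_iff, true_iff] at this
  exact hsub this rfl

/-- First-moment bound: the probability that the process contains an `n`-tuple of distinct points
from `K` is at most the measure of `K` for the product of the intensity measures. The tuples whose
points lie in distinct cells of a finite partition are treated cell by cell, and the partition is
then refined. -/
theorem IsPoissonProcess.measure_exists_tuple_le [IsProbabilityMeasure μ]
    (hL : IsPoissonProcess L lam μ) {n : ℕ}
    {K : Set (Fin n → EuclideanSpace ℝ (Fin d))} (hK : MeasurableSet K) :
    μ {ω | ∃ x ∈ K, Function.Injective x ∧ ∀ i, x i ∈ L ω} ≤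
      Measure.pi (fun _ => intensity d lam) K := by
  -- the tuples in the ball of radius `N` whose points are in distinct cells of the `N`-th partition
  let A : ℕ → Set Ω := fun N => {ω | ∃ x ∈ K, (∀ i, x i ∈ L ω) ∧
    (∀ i, x i ∈ Metric.closedBall 0 (N : ℝ)) ∧ Function.Injective fun i => cell d N (x i)}
  have hmono : Monotone A := by
    rintro N N' hN ω ⟨x, hx, hx1, hx2, hx3⟩
    exact ⟨x, hx, hx1, fun i => Metric.closedBall_subset_closedBall (by exact_mod_cast hN) (hx2 i),
      fun i j hij => hx3 (cell_eq_of_le hN hij)⟩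
  have hsub : {ω | ∃ x ∈ K, Function.Injective x ∧ ∀ i, x i ∈ L ω} ⊆ ⋃ N, A N := by
    rintro ω ⟨x, hx, hinj, hxL⟩
    have h1 : ∀ᶠ N : ℕ in Filter.atTop, ∀ i, x i ∈ Metric.closedBall 0 (N : ℝ) := by
      refine Filter.eventually_all.2 fun i => ?_
      filter_upwards [Filter.eventually_ge_atTop ⌈‖x i‖⌉₊] with N hN
      rw [mem_closedBall_zero_iff]
      exact Nat.ceil_le.1 hN
    have h2 : ∀ᶠ N : ℕ in Filter.atTop, ∀ i j, i ≠ j → cell d N (x i) ≠ cell d N (x j) := by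
      refine Filter.eventually_all.2 fun i => Filter.eventually_all.2 fun j => ?_
      by_cases hij : i = j
      · simp [hij]
      obtain ⟨N₀, hN₀⟩ := exists_cell_ne (hinj.ne hij)
      filter_upwards [Filter.eventually_ge_atTop N₀] with N hN _ he
      exact hN₀ (cell_eq_of_le hN he)
    obtain ⟨N, hN1, hN2⟩ := (h1.and h2).exists
    exact Set.mem_iUnion.2 ⟨N, x, hx, hxL, hN1, fun i j hij => by_contra fun h => hN2 i j h hij⟩
  refine (measure_mono hsub).trans ?_
  rw [hmono.measure_iUnion]
  refine iSup_le fun N => ?_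
  let J := {c : Fin n → Fin N → Prop // Function.Injective c}
  let B : J → Fin n → Set (EuclideanSpace ℝ (Fin d)) := fun c i =>
    {y | cell d N y = c.1 i} ∩ Metric.closedBall 0 (N : ℝ)
  let K' : J → Set (Fin n → EuclideanSpace ℝ (Fin d)) := fun c =>
    K ∩ {x | ∀ i, cell d N (x i) = c.1 i}
  have hK' : ∀ c, MeasurableSet (K' c) := fun c => by
    refine hK.inter ?_
    rw [Set.ofPred_forall]
    exact .iInter fun i => (measurableSet_cell_eq N (c.1 i)).preimage (measurable_pi_apply i)
  have hdisj : Pairwise (Function.onFun Disjoint K') := fun c c' hne => by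
    refine Set.disjoint_left.2 fun x hx hx' => hne (Subtype.ext (funext fun i => ?_))
    exact (hx.2 i).symm.trans (hx'.2 i)
  have hA : A N ⊆ ⋃ c, {ω | ∃ x ∈ K' c, ∀ i, x i ∈ L ω ∩ B c i} := by
    rintro ω ⟨x, hx, hx1, hx2, hx3⟩
    exact Set.mem_iUnion.2 ⟨⟨_, hx3⟩, x, ⟨hx, fun i => rfl⟩, fun i => ⟨hx1 i, rfl, hx2 i⟩⟩
  calc μ (A N) ≤ ∑' c, μ {ω | ∃ x ∈ K' c, ∀ i, x i ∈ L ω ∩ B c i} :=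
        (measure_mono hA).trans (measure_iUnion_le _)
    _ ≤ ∑' c, Measure.pi (fun _ => intensity d lam) (K' c) := by
        refine ENNReal.tsum_le_tsum fun c => hL.measure_exists_tuple_le_of_disjoint
          (fun i => (measurableSet_cell_eq N _).inter measurableSet_closedBall)
          (fun i => (measure_mono Set.inter_subset_right).trans_lt measure_closedBall_lt_top)
          (fun i j hij => ?_) (hK' c)
        refine Set.disjoint_left.2 fun y hy hy' => hij (c.2 ?_)
        exact hy.1.symm.trans hy'.1
    _ = Measure.pi (fun _ => intensity d lam) (⋃ c, K' c) := (measure_iUnion hdisj hK').symm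
    _ ≤ Measure.pi (fun _ => intensity d lam) K :=
        measure_mono (Set.iUnion_subset fun c => Set.inter_subset_left)

end Moments

/-! ### Infinite plays -/

section Chains

variable {E : Type*} [MetricSpace E]

/-- The graph that joins two points of `S` if their distance is between `a` and `b`. -/
def shellGraph (S : Set E) (a b : ℝ) : SimpleGraph E where
  Adj x y := x ≠ y ∧ x ∈ S ∧ y ∈ S ∧ dist x y ∈ Set.Ioo a b
  symm := ⟨fun x y h => ⟨h.1.symm, h.2.2.1, h.2.1, dist_comm x y ▸ h.2.2.2⟩⟩
  loopless := ⟨fun _ h => h.1 rfl⟩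

theorem finite_walk_ends {S : Set E} (hS : LocallyFiniteSet S) (a b : ℝ) (x : E) (n : ℕ) :
    {y | ∃ w : (shellGraph S a b).Walk x y, w.length = n}.Finite := by
  induction n generalizing x with
  | zero =>
    refine (Set.finite_singleton x).subset ?_
    rintro y ⟨w, hw⟩
    exact (SimpleGraph.Walk.eq_of_length_eq_zero hw).symm
  | succ n ih =>
    have hfin : {v | (shellGraph S a b).Adj x v}.Finite := (hS x b).subset fun v hv =>
      ⟨hv.2.2.1, by rw [Metric.mem_closedBall, dist_comm]; exact hv.2.2.2.2.le⟩
    refine (hfin.biUnion fun v _ => ih v).subset ?_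
    rintro y ⟨w, hw⟩
    cases w with
    | nil => simp at hw
    | cons h w => exact Set.mem_biUnion h ⟨w, by simpa using hw⟩

/-- `x` is a self-avoiding path with `n` steps in `S`, each of a length between `a` and `b`. -/
def IsChain (S : Set E) (a b : ℝ) (n : ℕ) (x : Fin (n + 1) → E) : Prop :=
  Function.Injective x ∧ (∀ i, x i ∈ S) ∧
    ∀ i : Fin n, dist (x i.castSucc) (x i.succ) ∈ Set.Ioo a b

/-- A component of the graph without paths of length `n` is finite: geodesics are paths, so all its
points are at a graph distance less than `n`. -/
theorem finite_reachable {S : Set E} (hS : LocallyFiniteSet S) {a b : ℝ} {x : E} (hx : x ∈ S)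
    {n : ℕ} (hn : ¬ ∃ y, IsChain S a b n y ∧ y 0 = x) :
    {y | (shellGraph S a b).Reachable x y}.Finite := by
  refine ((Set.finite_Iio n).biUnion fun m _ => finite_walk_ends hS a b x m).subset fun y hy => ?_
  obtain ⟨w, hw, -⟩ := hy.exists_path_of_dist
  refine Set.mem_biUnion (x := w.length) (Set.mem_Iio.2 ?_) ⟨w, rfl⟩
  by_contra hlt
  have hlen : n ≤ w.length := not_lt.1 hlt
  have hadj : ∀ i : Fin n,
      (shellGraph S a b).Adj (w.getVert i) (w.getVert (i + 1)) := fun i =>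
    w.adj_getVert_succ (by omega)
  refine hn ⟨fun i => w.getVert i, ⟨?_, ?_, fun i => ?_⟩, by simp⟩
  · intro i j hij
    exact Fin.ext (hw.getVert_injOn (show (i : ℕ) ≤ _ by omega) (show (j : ℕ) ≤ _ by omega) hij)
  · refine Fin.cases (by simpa using hx) fun i => ?_
    exact (hadj i).2.2.1
  · exact (hadj i).2.2.2

theorem pairDist_nonneg (p : Sym2 E) : 0 ≤ pairDist p := by
  induction p with | _ x y
  exact dist_nonneg

/-- Along an infinite play the distances decrease to a limit `r`. From some time on they lie in a
small interval around `r`, so that the play remains in one component of a shell graph; but this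
component is finite, and the positions are distinct. -/
theorem wellFounded_moves {S : Set E} (hS : LocallyFiniteSet S)
    (h : ∀ r : ℝ, ∃ a b : ℝ, a < r ∧ r < b ∧
      ∀ x ∈ S, ∃ n, ¬ ∃ y, IsChain S a b n y ∧ y 0 = x) :
    WellFounded (fun q p : pairs S => q ∈ moves p) := by
  rw [wellFounded_iff_isEmpty_descending_chain]
  refine ⟨fun ⟨f, hf⟩ => ?_⟩
  let l : ℕ → ℝ := fun n => pairDist (f n).1
  have hanti : StrictAnti l := strictAnti_nat_of_succ_lt fun n => (hf n).1
  have hbdd : BddBelow (Set.range l) := ⟨0, by rintro _ ⟨n, rfl⟩; exact pairDist_nonneg _⟩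
  obtain ⟨a, b, ha, hb, hab⟩ := h (⨅ n, l n)
  have hlim := tendsto_atTop_ciInf hanti.antitone hbdd
  obtain ⟨N, hN⟩ := Filter.eventually_atTop.1 (hlim.eventually_lt_const hb)
  have hIoo : ∀ n, N ≤ n → l n ∈ Set.Ioo a b := fun n hn =>
    ⟨ha.trans_le (ciInf_le hbdd n), hN n hn⟩
  have hadj : ∀ n, N ≤ n → ∀ u ∈ (f n).1, ∀ v ∈ (f n).1,
      (shellGraph S a b).Reachable u v := by
    intro n hn u hu v hv
    by_cases huv : u = v
    · rw [huv]
    have he := (Sym2.mem_and_mem_iff huv).1 ⟨hu, hv⟩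
    have hl := hIoo n hn
    simp only [l, he, pairDist_mk] at hl
    exact SimpleGraph.Adj.reachable ⟨huv, (f n).2.2 u hu, (f n).2.2 v hv, hl⟩
  obtain ⟨x, hx⟩ : ∃ x, x ∈ (f N).1 := ⟨_, Sym2.out_fst_mem _⟩
  have hreach : ∀ n, N ≤ n → ∀ z ∈ (f n).1, (shellGraph S a b).Reachable x z := by
    intro n hn
    induction n, hn using Nat.le_induction with
    | base => exact hadj N le_rfl x hx
    | succ n hn ih =>
      intro z hz
      obtain ⟨w, hw, hw'⟩ := (mem_moves_iff.1 (hf n)).2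
      exact (ih w hw).trans (hadj (n + 1) (by omega) w hw' z hz)
  obtain ⟨n, hn⟩ := hab x ((f N).2.2 x hx)
  have hfin := finite_reachable hS ((f N).2.2 x hx) hn
  have hfin2 := (hfin.prod hfin).image fun p => s(p.1, p.2)
  refine Set.infinite_of_injective_forall_mem (f := fun n => (f (N + n)).1) ?_ ?_ hfin2
  · intro m m' hmm
    have := hanti.injective (congrArg pairDist hmm : l (N + m) = l (N + m'))
    omega
  · intro m
    have hm := hreach (N + m) (by omega)
    generalize (f (N + m)).1 = q at hm
    induction q with | _ u v
    exact ⟨(u, v), ⟨hm u (by simp), hm v (by simp)⟩, rfl⟩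

end Chains

/-! ### Shells, isosceles triples and termination of the game -/

section Bounds

/-- If the last of `n + 1` coordinates is confined, given the others, to a set of measure at most
`c`, then adding it multiplies the measure at most by `c`. -/
theorem pi_measure_init_last_le {α : Type*} [MeasurableSpace α] {m : Measure α} [SigmaFinite m]
    {n : ℕ} {A : Set (Fin n → α)} (hA : MeasurableSet A) {T : (Fin n → α) → Set α} {c : ENNReal}
    (hT : ∀ y, m (T y) ≤ c) {K : Set (Fin (n + 1) → α)} (hK : MeasurableSet K)
    (hKA : ∀ x ∈ K, Fin.init x ∈ A ∧ x (Fin.last n) ∈ T (Fin.init x)) :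
    Measure.pi (fun _ => m) K ≤ c * Measure.pi (fun _ => m) A := by
  let e := MeasurableEquiv.piFinSuccAbove (fun _ : Fin (n + 1) => α) (Fin.last n)
  have hp : MeasurePreserving e _ _ :=
    measurePreserving_piFinSuccAbove (fun _ : Fin (n + 1) => m) (Fin.last n)
  have hK' : MeasurableSet (e.symm ⁻¹' K) := e.symm.measurable hK
  have hpre : K = e ⁻¹' (e.symm ⁻¹' K) := by
    ext x; simp
  rw [hpre, hp.measure_preimage hK'.nullMeasurableSet, Measure.prod_apply_symm hK',
    ← lintegral_indicator_const hA]
  refine lintegral_mono fun y => ?_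
  have hy : ∀ x, e.symm (x, y) ∈ K → y ∈ A ∧ x ∈ T y := fun x hx => by
    have h := hKA _ hx
    have h1 : Fin.init (e.symm (x, y)) = y := by
      funext i
      simp [e, Fin.init, MeasurableEquiv.piFinSuccAbove]
    have h2 : e.symm (x, y) (Fin.last n) = x := by
      simp [e, MeasurableEquiv.piFinSuccAbove]
    rwa [h1, h2] at h
  by_cases hyA : y ∈ A
  · rw [Set.indicator_of_mem hyA]
    exact (measure_mono fun x hx => (hy x hx).2).trans (hT y)
  · have : (fun x => (x, y)) ⁻¹' (e.symm ⁻¹' K) = ∅ :=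
      Set.eq_empty_of_forall_notMem fun x hx => hyA (hy x hx).1
    simp [this]

variable {d : ℕ} {lam : ℝ≥0}

/-- The spherical shell around the origin with radii `a` and `b`. -/
def shell (d : ℕ) (a b : ℝ) : Set (EuclideanSpace ℝ (Fin d)) := {y | ‖y‖ ∈ Set.Ioo a b}

theorem measurableSet_shell (a b : ℝ) : MeasurableSet (shell d a b) :=
  measurable_norm measurableSet_Ioo

theorem intensity_shell_translate (a b : ℝ) (z : EuclideanSpace ℝ (Fin d)) :
    intensity d lam {y | dist z y ∈ Set.Ioo a b} = intensity d lam (shell d a b) := by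
  have e : {y | dist z y ∈ Set.Ioo a b} = (fun y => -z + y) ⁻¹' shell d a b := by
    ext y
    simp [shell, dist_eq_norm', neg_add_eq_sub]
  rw [e, intensity_apply, intensity_apply, measure_preimage_add]

/-- The paths with `n` steps of a length between `a` and `b` that start in the ball of radius `R`. -/
def pathSet (d : ℕ) (a b R : ℝ) (n : ℕ) : Set (Fin (n + 1) → EuclideanSpace ℝ (Fin d)) :=
  {x | x 0 ∈ Metric.closedBall 0 R ∧ ∀ i : Fin n, dist (x i.castSucc) (x i.succ) ∈ Set.Ioo a b}

theorem measurableSet_pathSet (a b R : ℝ) (n : ℕ) : MeasurableSet (pathSet d a b R n) := by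
  have e : pathSet d a b R n = (fun x => x 0) ⁻¹' Metric.closedBall 0 R ∩
      ⋂ i : Fin n, (fun x => dist (x i.castSucc) (x i.succ)) ⁻¹' Set.Ioo a b := by
    ext x
    simp [pathSet]
  rw [e]
  have h0 : Measurable fun x : Fin (n + 1) → EuclideanSpace ℝ (Fin d) => x 0 :=
    measurable_pi_apply 0
  have hi : ∀ i : Fin n, Measurable fun x : Fin (n + 1) → EuclideanSpace ℝ (Fin d) =>
      dist (x i.castSucc) (x i.succ) := fun i =>
    (measurable_pi_apply i.castSucc).dist (measurable_pi_apply i.succ)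
  exact (h0 measurableSet_closedBall).inter (.iInter fun i => hi i measurableSet_Ioo)

theorem pi_intensity_pathSet_le (a b R : ℝ) (n : ℕ) :
    Measure.pi (fun _ => intensity d lam) (pathSet d a b R n) ≤
      intensity d lam (shell d a b) ^ n * intensity d lam (Metric.closedBall 0 R) := by
  induction n with
  | zero =>
    have e : pathSet d a b R 0 = Set.pi Set.univ fun _ => Metric.closedBall 0 R := by
      ext x
      simp [pathSet, Set.mem_pi]
    rw [e, Measure.pi_pi]
    simp
  | succ n ih =>
    rw [pow_succ', mul_assoc]
    refine le_trans ?_ (mul_le_mul_right ih _)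
    refine pi_measure_init_last_le (measurableSet_pathSet a b R n)
      (T := fun y => {z | dist (y (Fin.last n)) z ∈ Set.Ioo a b})
      (fun y => (intensity_shell_translate a b _).le) (measurableSet_pathSet a b R (n + 1)) ?_
    rintro x ⟨hx0, hx⟩
    exact ⟨⟨hx0, fun i => hx i.castSucc⟩, hx (Fin.last n)⟩

theorem exists_intensity_shell_lt_one (hd : 1 ≤ d) (r : ℝ) :
    ∃ a b : ℚ, (a : ℝ) < r ∧ r < b ∧ intensity d lam (shell d a b) < 1 := by
  have : Nonempty (Fin d) := ⟨⟨0, hd⟩⟩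
  have hsphere : intensity d lam (Metric.sphere 0 r) = 0 := by
    rw [intensity_apply, Measure.addHaar_sphere, mul_zero]
  let u : ℕ → ℝ := fun n => 1 / ((n : ℝ) + 1)
  have hu : Filter.Tendsto u Filter.atTop (nhds 0) := tendsto_one_div_add_atTop_nhds_zero_nat
  have hupos : ∀ n, 0 < u n := fun n => Nat.one_div_pos_of_nat
  have hmono : Antitone fun n => shell d (r - u n) (r + u n) := by
    intro n m hnm y hy
    have : u m ≤ u n := Nat.one_div_le_one_div hnm
    exact ⟨by linarith [hy.1], by linarith [hy.2]⟩
  have hInter : ⋂ n, shell d (r - u n) (r + u n) = Metric.sphere 0 r := by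
    ext y
    simp only [Set.mem_iInter, mem_sphere_zero_iff_norm]
    constructor
    · intro h
      have h1 : r - 0 ≤ ‖y‖ :=
        le_of_tendsto (tendsto_const_nhds.sub hu) (.of_forall fun n => (h n).1.le)
      have h2 : ‖y‖ ≤ r + 0 :=
        ge_of_tendsto (tendsto_const_nhds.add hu) (.of_forall fun n => (h n).2.le)
      linarith
    · intro h n
      have := hupos n
      exact ⟨by linarith, by linarith⟩
  have hlim := tendsto_measure_iInter_atTop (μ := intensity d lam)
    (fun n => (measurableSet_shell (d := d) (r - u n) (r + u n)).nullMeasurableSet) hmono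
    ⟨0, by
      refine ne_top_of_le_ne_top (b := intensity d lam (Metric.closedBall 0 (r + u 0))) ?_
        (measure_mono fun y hy => mem_closedBall_zero_iff.2 hy.2.le)
      rw [intensity_apply]
      exact ENNReal.mul_ne_top ENNReal.coe_ne_top measure_closedBall_lt_top.ne⟩
  rw [hInter, hsphere] at hlim
  obtain ⟨n, hn⟩ := (hlim.eventually_lt_const zero_lt_one).exists
  obtain ⟨a, ha, ha'⟩ := exists_rat_btwn (show r - u n < r by linarith [hupos n])
  obtain ⟨b, hb, hb'⟩ := exists_rat_btwn (show r < r + u n by linarith [hupos n])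
  refine ⟨a, b, ha', hb, lt_of_le_of_lt (measure_mono fun y hy => ?_) hn⟩
  exact ⟨ha.trans hy.1, hy.2.trans hb'⟩

variable {Ω : Type*} [MeasurableSpace Ω] {μ : Measure Ω} [IsProbabilityMeasure μ]
  {L : Ω → Set (EuclideanSpace ℝ (Fin d))}

/-- If a shell has measure less than `1`, then the expected number of paths with `n` steps from that
shell that start in a given ball tends to `0`. -/
theorem IsPoissonProcess.ae_exists_no_chain (hL : IsPoissonProcess L lam μ) {a b : ℝ}
    (hab : intensity d lam (shell d a b) < 1) (R : ℝ) :
    ∀ᵐ ω ∂μ, ∃ n, ¬ ∃ y, IsChain (L ω) a b n y ∧ y 0 ∈ Metric.closedBall 0 R := by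
  have hbound : ∀ n, μ {ω | ¬ ∃ n, ¬ ∃ y, IsChain (L ω) a b n y ∧ y 0 ∈ Metric.closedBall 0 R} ≤
      intensity d lam (shell d a b) ^ n * intensity d lam (Metric.closedBall 0 R) := by
    intro n
    refine le_trans (measure_mono fun ω hω => ?_) ((hL.measure_exists_tuple_le
      (measurableSet_pathSet a b R n)).trans (pi_intensity_pathSet_le a b R n))
    obtain ⟨y, hy, hy0⟩ := not_not.1 (not_exists.1 hω n)
    exact ⟨y, ⟨hy0, hy.2.2⟩, hy.1, hy.2.1⟩
  have hfin : intensity d lam (Metric.closedBall 0 R) ≠ ⊤ := by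
    rw [intensity_apply]
    exact ENNReal.mul_ne_top ENNReal.coe_ne_top measure_closedBall_lt_top.ne
  have hlim := ENNReal.Tendsto.mul_const (b := intensity d lam (Metric.closedBall 0 R))
    (ENNReal.tendsto_pow_atTop_nhds_zero_of_lt_one hab) (Or.inr hfin)
  rw [zero_mul] at hlim
  exact le_antisymm (ge_of_tendsto' hlim hbound) zero_le

theorem IsPoissonProcess.ae_dist_ne (hL : IsPoissonProcess L lam μ) (hd : 1 ≤ d) :
    ∀ᵐ ω ∂μ, ∀ x ∈ L ω, ∀ y ∈ L ω, ∀ z ∈ L ω, x ≠ y → x ≠ z → y ≠ z → dist x y ≠ dist x z := by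
  have : Nonempty (Fin d) := ⟨⟨0, hd⟩⟩
  let K : Set (Fin 3 → EuclideanSpace ℝ (Fin d)) := {x | dist (x 0) (x 1) = dist (x 0) (x 2)}
  have hK : MeasurableSet K := measurableSet_eq_fun
    ((measurable_pi_apply _).dist (measurable_pi_apply _))
    ((measurable_pi_apply _).dist (measurable_pi_apply _))
  have hK0 : Measure.pi (fun _ => intensity d lam) K ≤ 0 := by
    refine (pi_measure_init_last_le (c := 0) MeasurableSet.univ
      (T := fun y => Metric.sphere (y 0) (dist (y 0) (y 1))) (fun y => ?_) hK ?_).trans (by simp)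
    · rw [intensity_apply, Measure.addHaar_sphere, mul_zero]
    · intro x hx
      refine ⟨trivial, ?_⟩
      rw [Metric.mem_sphere, dist_comm]
      exact hx.symm
  refine le_antisymm ((measure_mono ?_).trans ((hL.measure_exists_tuple_le hK).trans hK0)) zero_le
  intro ω hω
  simp only [Set.mem_compl_iff, Set.mem_ofPred_eq, not_forall, not_not] at hω
  obtain ⟨x, hx, y, hy, z, hz, hxy, hxz, hyz, h⟩ := hω
  refine ⟨![x, y, z], h, ?_, ?_⟩
  · intro i j
    fin_cases i <;> fin_cases j <;> simp [hxy, hxz, hyz, hxy.symm, hxz.symm, hyz.symm]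
  · intro i
    fin_cases i <;> simpa

theorem IsPoissonProcess.ae_good (hL : IsPoissonProcess L lam μ) (hd : 1 ≤ d) :
    ∀ᵐ ω ∂μ, Good (L ω) := by
  have hchain : ∀ᵐ ω ∂μ, ∀ a b : ℚ, intensity d lam (shell d a b) < 1 → ∀ R : ℕ,
      ∃ n, ¬ ∃ y, IsChain (L ω) a b n y ∧ y 0 ∈ Metric.closedBall 0 (R : ℝ) := by
    refine ae_all_iff.2 fun a => ae_all_iff.2 fun b => ?_
    by_cases hab : intensity d lam (shell d a b) < 1
    · simpa only [hab, true_imp_iff] using ae_all_iff.2 fun R : ℕ => hL.ae_exists_no_chain hab R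
    · simp [hab]
  filter_upwards [hL.ae_locallyFiniteSet, hL.ae_dist_ne hd, hchain] with ω h1 h2 h3
  refine ⟨h1, h2, wellFounded_moves h1 fun r => ?_⟩
  obtain ⟨a, b, ha, hb, hab⟩ := exists_intensity_shell_lt_one (lam := lam) hd r
  refine ⟨a, b, ha, hb, fun x _ => ?_⟩
  obtain ⟨n, hn⟩ := h3 a b hab ⌈‖x‖⌉₊
  refine ⟨n, fun ⟨y, hy, hyx⟩ => hn ⟨y, hy, ?_⟩⟩
  rw [hyx, mem_closedBall_zero_iff]
  exact Nat.le_ceil _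

end Bounds

/-! ### Translation invariance and perfect matchings -/

section Matching

variable {Ω : Type*} [MeasurableSpace Ω] {μ : Measure Ω} [IsProbabilityMeasure μ] {d : ℕ}
  {lam : ℝ≥0} {L : Ω → Set (EuclideanSpace ℝ (Fin d))}

theorem mk_mem_lackEvent_iff {S : Set (EuclideanSpace ℝ (Fin d))} (hS : LocallyFiniteSet S) (k : ℕ)
    (Q : Set (EuclideanSpace ℝ (Fin d))) :
    Config.mk S ∈ lackEvent k Q ↔ ∃ x ∈ S, x ∈ Q ∧ Lacks S k x := by
  rw [lackEvent, Set.mem_ofPred_eq, labelledPoints_eq (S := ⟨S⟩) hS]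

theorem LocallyFiniteSet.image {E : Type*} [MetricSpace E] {S : Set E} (hS : LocallyFiniteSet S)
    (f : E ≃ᵢ E) : LocallyFiniteSet (f '' S) := fun x r => by
  refine ((hS (f.symm x) r).image f).subset ?_
  rintro _ ⟨⟨y, hy, rfl⟩, hyr⟩
  refine ⟨y, ⟨hy, ?_⟩, rfl⟩
  rwa [Metric.mem_closedBall, ← f.isometry.dist_eq, f.apply_symm_apply]

/-- Translation invariance of the process, for the event that some point of a ball has no partner
for the value `k`. -/
theorem IsPoissonProcess.measure_lackEvent_ball (hL : IsPoissonProcess L lam μ) (k : ℕ) (R : ℝ)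
    (z : EuclideanSpace ℝ (Fin d)) :
    NullMeasurableSet {ω | Config.mk (L ω) ∈ lackEvent k (Metric.ball z R)} μ ∧
      μ {ω | Config.mk (L ω) ∈ lackEvent k (Metric.ball z R)} =
        μ {ω | Config.mk (L ω) ∈ lackEvent k (Metric.ball 0 R)} := by
  let f := IsometryEquiv.addRight z
  have hvoid : ∀ B, MeasurableSet B → volume B < ⊤ →
      NullMeasurableSet {ω | Disjoint (L ω) B} μ ∧
      NullMeasurableSet {ω | Disjoint (f '' L ω) B} μ ∧
      μ {ω | Disjoint (L ω) B} = μ {ω | Disjoint (f '' L ω) B} := by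
    intro B hB hv
    have hB' : MeasurableSet (f ⁻¹' B) := f.continuous.measurable hB
    have hvol : volume (f ⁻¹' B) = volume B := measure_preimage_add_right volume z B
    have e : ∀ ω, Disjoint (f '' L ω) B ↔ Disjoint (L ω) (f ⁻¹' B) := fun ω =>
      Set.disjoint_image_left
    simp only [e]
    refine ⟨hL.nullMeasurableSet_disjoint hB hv,
      hL.nullMeasurableSet_disjoint hB' (hvol ▸ hv), ?_⟩
    rw [hL.measure_disjoint hB hv, hL.measure_disjoint hB' (hvol ▸ hv), hvol]
  obtain ⟨h1, -, h3⟩ := measure_mem_eq_of_void hvoid _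
    (measurableSet_lackEvent k (measurableSet_ball (x := z) (ε := R)))
  refine ⟨h1, h3.trans (measure_congr ?_)⟩
  filter_upwards [hL.ae_locallyFiniteSet] with ω hω
  refine propext ?_
  change Config.mk (f '' L ω) ∈ lackEvent k (Metric.ball z R) ↔
    Config.mk (L ω) ∈ lackEvent k (Metric.ball 0 R)
  rw [mk_mem_lackEvent_iff hω, mk_mem_lackEvent_iff (hω.image f), Set.exists_mem_image]
  simp only [lacks_image]
  simp [f]

/-- Almost surely all points have a partner for the value `k`. There are finitely many others, hence
almost surely only finitely many of infinitely many disjoint balls of the same radius contain one of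
them; but all these balls do so with the same probability. -/
theorem IsPoissonProcess.ae_unmatched_eq_empty (hL : IsPoissonProcess L lam μ) (hd : 1 ≤ d)
    (k : ℕ) : ∀ᵐ ω ∂μ, ∀ hω : Good (L ω), unmatched hω k = ∅ := by
  have : Nonempty (Fin d) := ⟨⟨0, hd⟩⟩
  have hR : ∀ R : ℕ, μ {ω | Config.mk (L ω) ∈ lackEvent k (Metric.ball 0 (R : ℝ))} = 0 := by
    intro R
    obtain ⟨w, hw⟩ := exists_norm_eq (EuclideanSpace ℝ (Fin d))
      (show (0 : ℝ) ≤ 2 * R + 1 by positivity)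
    let A : ℕ → Set Ω := fun n =>
      {ω | Config.mk (L ω) ∈ lackEvent k (Metric.ball ((n : ℝ) • w) (R : ℝ))}
    have hA : ∀ n, NullMeasurableSet (A n) μ := fun n => (hL.measure_lackEvent_ball k R _).1
    have hlim := tendsto_measure_iInter_atTop (μ := μ) (s := fun n => ⋃ m ≥ n, A m)
      (fun n => .iUnion fun m => .iUnion fun _ => hA m)
      (fun n n' h => Set.biUnion_subset_biUnion_left fun m hm => le_trans h hm)
      ⟨0, measure_ne_top _ _⟩
    have hzero : μ (⋂ n, ⋃ m ≥ n, A m) = 0 := by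
      refine measure_mono_null (t := {ω | ¬ Good (L ω)}) (fun ω hω hgood => ?_) (hL.ae_good hd)
      have hinf : {n | ω ∈ A n}.Infinite := Set.infinite_of_not_bddAbove fun ⟨N, hN⟩ => by
        obtain ⟨m, hm, hmA⟩ := Set.mem_iUnion₂.1 (Set.mem_iInter.1 hω (N + 1))
        have := hN hmA
        omega
      have hpt : ∀ n, ω ∈ A n → ∃ x ∈ unmatched hgood k, x ∈ Metric.ball ((n : ℝ) • w) (R : ℝ) := by
        intro n hn
        obtain ⟨x, hx, hxb, hlack⟩ := (mk_mem_lackEvent_iff hgood.locallyFinite k _).1 hn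
        exact ⟨x, (mem_unmatched_iff hgood k x).2 ⟨hx, hlack⟩, hxb⟩
      choose! x hx hxb using hpt
      refine hinf (Set.Finite.of_finite_image (f := x) ((finite_unmatched hgood k).subset ?_) ?_)
      · rintro _ ⟨n, hn, rfl⟩
        exact hx n hn
      · intro n hn m hm hnm
        by_contra hne
        have h1 := Metric.mem_ball.1 (hxb n hn)
        have h2 := Metric.mem_ball.1 (hxb m hm)
        rw [← hnm] at h2
        have h3 := dist_triangle_left ((n : ℝ) • w) ((m : ℝ) • w) (x n)
        rw [dist_eq_norm, ← sub_smul, norm_smul, hw, Real.norm_eq_abs] at h3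
        have h4 : (1 : ℝ) ≤ |(n : ℝ) - m| := by
          have : (1 : ℤ) ≤ |(n : ℤ) - m| := Int.one_le_abs (by omega)
          exact_mod_cast this
        nlinarith [Nat.cast_nonneg (α := ℝ) R]
    rw [hzero] at hlim
    refine le_antisymm (ge_of_tendsto' hlim fun n => ?_) zero_le
    rw [← (hL.measure_lackEvent_ball k R ((n : ℝ) • w)).2]
    exact measure_mono (Set.subset_biUnion_of_mem (u := A) (le_refl n))
  filter_upwards [ae_all_iff.2 fun R : ℕ => measure_eq_zero_iff_ae_notMem.1 (hR R)] with ω h hω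
  refine Set.eq_empty_of_forall_notMem fun x hx => ?_
  obtain ⟨R, hR⟩ := exists_nat_gt ‖x‖
  obtain ⟨hxL, hlack⟩ := (mem_unmatched_iff hω k x).1 hx
  exact h R ((mk_mem_lackEvent_iff hω.locallyFinite k _).2
    ⟨x, hxL, mem_ball_zero_iff.2 hR, hlack⟩)

end Matching

end FriendlyFrogs

theorem mainTheorem6 {Ω : Type*} [MeasurableSpace Ω] (μ : Measure Ω) [IsProbabilityMeasure μ]
    (d : ℕ) (hd : 1 ≤ d) (lam : ℝ≥0) (hlam : 0 < lam)
    (L : Ω → Set (EuclideanSpace ℝ (Fin d)))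
    (hL : FriendlyFrogs.IsPoissonProcess L lam μ) :
    ∀ᵐ ω ∂μ, ∃ G : FriendlyFrogs.pairs (L ω) → ℕ,
      (∀ x ∈ L ω, ∀ k : ℕ, ∃! y : EuclideanSpace ℝ (Fin d),
        ∃ h : s(x, y) ∈ FriendlyFrogs.pairs (L ω), G ⟨s(x, y), h⟩ = k) ∧
      (∀ p : FriendlyFrogs.pairs (L ω),
        G '' FriendlyFrogs.moves p ≠ Set.univ ∧
        G p = FriendlyFrogs.mex (G '' FriendlyFrogs.moves p)) := by
  filter_upwards [hL.ae_good hd, ae_all_iff.2 (hL.ae_unmatched_eq_empty hd)] with ω hgood hempty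
  refine ⟨FriendlyFrogs.grundy hgood, fun x hx k => ?_, fun p =>
    ⟨FriendlyFrogs.image_grundy_ne_univ hgood p, FriendlyFrogs.grundy_eq hgood p⟩⟩
  have hx' : x ∉ FriendlyFrogs.unmatched hgood k := by simp [hempty k hgood]
  obtain ⟨y, hy, hk⟩ : ∃ y, ∃ h : s(x, y) ∈ FriendlyFrogs.pairs (L ω),
      FriendlyFrogs.grundy hgood ⟨_, h⟩ = k := by
    by_contra hcon
    exact hx' ⟨hx, fun y h hk => hcon ⟨y, h, hk⟩⟩
  refine ⟨y, ⟨hy, hk⟩, ?_⟩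
  rintro z ⟨hz, hzk⟩
  exact FriendlyFrogs.eq_of_grundy_eq hgood hz hy (hzk.trans hk.symm)
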